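/- There exist $\delta>0$ and functions $r_1,r_2$ with $r_i(\epsilon)=o(\epsilon)$ as $\epsilon\to0^+$ (depending on nothing else; in particular not on the dimension or on the distributions) such that the following holds. Let $n\ge 0$ and let $\mathcal N_i=\mathcal N(\mu_i,\Sigma_i)$, $i\in\{1,2,3\}$, be Gaussian distributions on $\mathbb R^n$ with positive definite covariance matrices $\Sigma_i$, such that $$\mathrm{KL}(\mathcal N_1\,\|\,\mathcal N_2)=\epsilon_1,\qquad \mathrm{KL}(\mathcal N_2\,\|\,\mathcal N_3)=\epsilon_2,\qquad 0<\epsilon_1,\epsilon_2<\delta,$$ where $\mathrm{KL}(P\,\|\,Q)=\int \log\frac{dP}{dQ}\,dP$ is the Kullback–Leibler divergence (natural logarithm). Then $\mathrm{KL}(\mathcal N_1\,\|\,\mathcal N_3)$ is finite and $$\mathrm{KL}(\mathcal N_1\,\|\,\mathcal N_3)\le \epsilon_1+\epsilon_2+2\sqrt{\epsilon_1\epsilon_2}+r_1(\epsilon_1)+r_2(\epsilon_2).$$ -/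

import Mathlib

open MeasureTheory ProbabilityTheory InformationTheory Asymptotics
open scoped Topology ENNReal

/-! Whitening by the middle Gaussian turns the covariance of the first and the precision of the
third into positive definite `A`, `B`, and the means relative to `μ₂` into `a`, `c`. With φ(M) = tr
M − n − log det M, the closed form of the divergence gives 2ε₁ = φ(A) + |a|² = s² and 2ε₂ = φ(B) +
cᵀBc = u². In 2 KL(𝒩₁‖𝒩₃) the log determinants split, so its excess over s² + u² is exactly
tr((B−1)(A−1)) + (aᵀBa − aᵀa) − 2aᵀBc.

Since x − 1 − log x behaves like (x−1)²/2 near 1, φ controls ‖M−1‖² in Frobenius norm with sharp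
leading constant (`Real.sq_sub_one_le_mul_max`) and keeps the eigenvalues below 1 + O(s) or 1 +
O(u). Cauchy–Schwarz for traces, for the form `B` and across the covariance and mean parts then
bounds the excess by 2su plus cubic terms (`cross_term_le_of_sq_bounds`), with no dependence on the
dimension. -/

/-! ### Lebesgue densities of Gaussian measures. -/

theorem MeasurableEquiv.map_withDensity_comp {α β : Type*} [MeasurableSpace α] [MeasurableSpace β]
    (e : α ≃ᵐ β) (ν : Measure α) (f : β → ℝ≥0∞) (hf : Measurable f) :
    (ν.withDensity (f ∘ e)).map e = (ν.map e).withDensity f := by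
  ext s hs
  rw [Measure.map_apply e.measurable hs, withDensity_apply _ (e.measurable hs),
    withDensity_apply _ hs, setLIntegral_map hs hf e.measurable]
  rfl

theorem pi_gaussianReal_eq_withDensity (ι : Type*) [Fintype ι] :
    Measure.pi (fun _ : ι ↦ gaussianReal 0 1) =
      (volume : Measure (ι → ℝ)).withDensity
        (fun x ↦ ENNReal.ofReal (∏ i, gaussianPDFReal 0 1 (x i))) := by
  refine Measure.pi_eq fun s hs ↦ ?_
  have hind (x : ι → ℝ) : (Set.univ.pi s).indicator
      (fun x ↦ ENNReal.ofReal (∏ i, gaussianPDFReal 0 1 (x i))) x =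
      ENNReal.ofReal (∏ i, (s i).indicator (gaussianPDFReal 0 1) (x i)) := by
    by_cases hx : x ∈ Set.univ.pi s
    · rw [Set.indicator_of_mem hx]
      congr 1
      exact Finset.prod_congr rfl fun i _ ↦ (Set.indicator_of_mem (hx i (Set.mem_univ i)) _).symm
    · rw [Set.indicator_of_notMem hx]
      obtain ⟨i, hi⟩ : ∃ i, x i ∉ s i := by simpa [Set.mem_pi] using hx
      rw [Finset.prod_eq_zero (Finset.mem_univ i) (Set.indicator_of_notMem hi _),
        ENNReal.ofReal_zero]
  have hint (i : ι) : Integrable ((s i).indicator (gaussianPDFReal 0 1)) :=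
    (integrable_gaussianPDFReal 0 1).indicator (hs i)
  have hnonneg (i : ι) (x : ℝ) : 0 ≤ (s i).indicator (gaussianPDFReal 0 1) x :=
    Set.indicator_nonneg (fun _ _ ↦ gaussianPDFReal_nonneg _ _ _) _
  rw [withDensity_apply _ (MeasurableSet.univ_pi hs), ← lintegral_indicator (MeasurableSet.univ_pi hs)]
  simp_rw [hind]
  rw [← ofReal_integral_eq_lintegral_ofReal (by rw [volume_pi]; exact Integrable.fintype_prod hint)
    (ae_of_all _ fun x ↦ Finset.prod_nonneg fun i _ ↦ hnonneg i _),
    integral_fintype_prod_volume_eq_prod,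
    ENNReal.ofReal_prod_of_nonneg fun i _ ↦ integral_nonneg (hnonneg i)]
  refine Finset.prod_congr rfl fun i _ ↦ ?_
  rw [gaussianReal_apply_eq_integral 0 one_ne_zero, integral_indicator (hs i)]

theorem prod_gaussianPDFReal_zero_one {ι : Type*} [Fintype ι] (x : ι → ℝ) :
    ∏ i, gaussianPDFReal 0 1 (x i) =
      Real.exp (-(Fintype.card ι * Real.log (2 * Real.pi)) / 2 - x ⬝ᵥ x / 2) := by
  have h (y : ℝ) : gaussianPDFReal 0 1 y =
      Real.exp (-Real.log (2 * Real.pi) / 2 - y * y / 2) := by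
    rw [sub_eq_add_neg, Real.exp_add, gaussianPDFReal]
    congr 1
    · rw [NNReal.coe_one, mul_one, Real.sqrt_eq_rpow, ← Real.rpow_neg (by positivity),
        Real.rpow_def_of_pos (by positivity)]
      congr 1
      ring
    · congr 1
      simp
      ring
  simp_rw [h, ← Real.exp_sum, Finset.sum_sub_distrib, dotProduct, Finset.sum_div]
  simp
  ring

theorem stdGaussian_eq_withDensity (ι : Type*) [Fintype ι] :
    stdGaussian (EuclideanSpace ℝ ι) = volume.withDensity (fun x ↦ ENNReal.ofReal (Real.exp
      (-(Fintype.card ι * Real.log (2 * Real.pi)) / 2 - x.ofLp ⬝ᵥ x.ofLp / 2))) := by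
  have h := (MeasurableEquiv.toLp 2 (ι → ℝ)).map_withDensity_comp volume
    (fun x ↦ ENNReal.ofReal (Real.exp
      (-(Fintype.card ι * Real.log (2 * Real.pi)) / 2 - x.ofLp ⬝ᵥ x.ofLp / 2)))
      (by unfold dotProduct; fun_prop)
  rw [← map_pi_eq_stdGaussian, pi_gaussianReal_eq_withDensity]
  simp_rw [prod_gaussianPDFReal_zero_one]
  rw [MeasurableEquiv.coe_toLp, (PiLp.volume_preserving_toLp ι).map_eq] at h
  exact h

-- Change of variables along x ↦ μ + √S x, which carries the standard Gaussian to this one; the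
-- Jacobian |det √S| supplies the log-determinant term.
open Matrix MatrixOrder in
theorem multivariateGaussian_eq_withDensity {ι : Type*} [Fintype ι] [DecidableEq ι]
    (μ : EuclideanSpace ℝ ι) {S : Matrix ι ι ℝ} (hS : S.PosDef) :
    multivariateGaussian μ S = volume.withDensity (fun x ↦ ENNReal.ofReal (Real.exp
      (-(Fintype.card ι * Real.log (2 * Real.pi)) / 2 - Real.log S.det / 2
        - (x - μ).ofLp ⬝ᵥ S⁻¹ *ᵥ (x - μ).ofLp / 2))) := by
  set R := CFC.sqrt S with hR
  have hRR : R * R = S := CFC.sqrt_mul_sqrt_self _ hS.posSemidef.nonneg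
  have hdet : R.det * R.det = S.det := by rw [← det_mul, hRR]
  have hdet0 : R.det ≠ 0 := fun h ↦ hS.det_pos.ne' (by rw [← hdet, h, zero_mul])
  have hunit : IsUnit R.det := isUnit_iff_ne_zero.2 hdet0
  have hRT : Rᵀ = R := (CFC.sqrt_nonneg S).isSelfAdjoint
  have hlog : Real.log S.det / 2 = Real.log |R.det| := by
    rw [← hdet, Real.log_mul hdet0 hdet0, Real.log_abs]; ring
  let e : EuclideanSpace ℝ ι ≃ᵐ EuclideanSpace ℝ ι :=
    { toFun := fun x ↦ μ + toEuclideanCLM (𝕜 := ℝ) R x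
      invFun := fun x ↦ toEuclideanCLM (𝕜 := ℝ) R⁻¹ (x - μ)
      left_inv := fun x ↦ by
        simp only [add_sub_cancel_left]
        rw [← ContinuousLinearMap.comp_apply, ← ContinuousLinearMap.mul_def, ← map_mul,
          nonsing_inv_mul _ hunit, map_one, one_apply_eq_self]
      right_inv := fun x ↦ by
        simp only
        rw [← ContinuousLinearMap.comp_apply, ← ContinuousLinearMap.mul_def, ← map_mul,
          mul_nonsing_inv _ hunit, map_one, one_apply_eq_self, add_sub_cancel]
      measurable_toFun := by simp only [Equiv.coe_fn_mk]; fun_prop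
      measurable_invFun := by simp only [Equiv.coe_fn_symm_mk]; fun_prop }
  have hvol : (volume : Measure (EuclideanSpace ℝ ι)).map e = ENNReal.ofReal |R.det|⁻¹ • volume := by
    have h1 : (e : EuclideanSpace ℝ ι → EuclideanSpace ℝ ι) =
      (fun x ↦ μ + x) ∘ (toEuclideanCLM (𝕜 := ℝ) R).toLinearMap := rfl
    have h2 : LinearMap.det (toEuclideanCLM (𝕜 := ℝ) R).toLinearMap = R.det := by
      rw [coe_toEuclideanCLM_eq_toEuclideanLin]
      exact LinearMap.det_toLin (PiLp.basisFun 2 ℝ ι) R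
    rw [h1, ← Measure.map_map (measurable_const_add μ) (by fun_prop),
      Measure.map_linearMap_addHaar_eq_smul_addHaar _ (by rw [h2]; exact hdet0), h2,
      Measure.map_smul, map_add_left_eq_self, abs_inv]
  have hquad (x : EuclideanSpace ℝ ι) : (e x - μ).ofLp ⬝ᵥ S⁻¹ *ᵥ (e x - μ).ofLp =
      x.ofLp ⬝ᵥ x.ofLp := by
    have : (e x - μ).ofLp = R *ᵥ x.ofLp := by
      simp [e]
    rw [this, ← hRR, Matrix.mul_inv_rev, mulVec_mulVec, Matrix.mul_assoc,
      nonsing_inv_mul _ hunit, Matrix.mul_one, dotProduct_mulVec, vecMul_mulVec, hRT,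
      mul_nonsing_inv _ hunit, vecMul_one]
  have hmeas : Measurable fun x : EuclideanSpace ℝ ι ↦ ENNReal.ofReal (Real.exp
      (-(Fintype.card ι * Real.log (2 * Real.pi)) / 2
        - (x - μ).ofLp ⬝ᵥ S⁻¹ *ᵥ (x - μ).ofLp / 2)) := by
    unfold Matrix.mulVec dotProduct
    fun_prop
  have h := e.map_withDensity_comp volume _ hmeas
  simp only [Function.comp_def, hquad] at h
  rw [hvol, ← stdGaussian_eq_withDensity, withDensity_smul_measure,
    ← withDensity_smul _ hmeas] at h
  refine Eq.trans ?_ (h.trans ?_)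
  · rfl
  · congr 1
    ext x
    rw [Pi.smul_apply, smul_eq_mul, ← ENNReal.ofReal_mul (by positivity), hlog, sub_right_comm,
      Real.exp_sub _ (Real.log _), Real.exp_log (abs_pos.2 hdet0), div_eq_inv_mul _ |R.det|]

/-! ### Closed form of the Gaussian divergence. -/

theorem klDiv_withDensity_exp {α : Type*} [MeasurableSpace α] {ν μ₁ μ₂ : Measure α} [SigmaFinite ν]
    [IsProbabilityMeasure μ₁] [IsProbabilityMeasure μ₂] {f g : α → ℝ} (hf : Measurable f)
    (hg : Measurable g) (h₁ : μ₁ = ν.withDensity fun x ↦ ENNReal.ofReal (Real.exp (f x)))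
    (h₂ : μ₂ = ν.withDensity fun x ↦ ENNReal.ofReal (Real.exp (g x)))
    (hint : Integrable (fun x ↦ f x - g x) μ₁) :
    klDiv μ₁ μ₂ ≠ ∞ ∧ (klDiv μ₁ μ₂).toReal = ∫ x, f x - g x ∂μ₁ := by
  have h₁₂ : μ₁ = μ₂.withDensity fun x ↦ ENNReal.ofReal (Real.exp (f x - g x)) := by
    rw [h₁, h₂, ← withDensity_mul _ (by fun_prop) (by fun_prop)]
    congr 1
    ext x
    rw [Pi.mul_apply, ← ENNReal.ofReal_mul (Real.exp_pos _).le, ← Real.exp_add, add_sub_cancel]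
  have hac : μ₁ ≪ μ₂ := h₁₂ ▸ withDensity_absolutelyContinuous _ _
  have hllr : llr μ₁ μ₂ =ᵐ[μ₁] fun x ↦ f x - g x := by
    have h := Measure.rnDeriv_withDensity μ₂
      (f := fun x ↦ ENNReal.ofReal (Real.exp (f x - g x))) (by fun_prop)
    rw [← h₁₂] at h
    filter_upwards [hac.ae_le h] with x hx
    rw [llr, hx, ENNReal.toReal_ofReal (Real.exp_pos _).le, Real.log_exp]
  refine ⟨klDiv_ne_top hac (hint.congr hllr.symm), ?_⟩
  rw [toReal_klDiv_of_measure_eq hac (by simp), integral_congr_ae hllr]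

section
open Matrix
variable {ι : Type*} [Fintype ι] [DecidableEq ι] (μ₁ μ₂ : EuclideanSpace ℝ ι) {S₁ S₂ : Matrix ι ι ℝ}

theorem memLp_eval_sub_multivariateGaussian (S : Matrix ι ι ℝ) (i : ι) :
    MemLp (fun x : EuclideanSpace ℝ ι ↦ x i - μ₂ i) 2 (multivariateGaussian μ₁ S) := by
  have h : MemLp (fun x : EuclideanSpace ℝ ι ↦ x i) 2 (multivariateGaussian μ₁ S) :=
    (EuclideanSpace.proj (𝕜 := ℝ) i).comp_memLp' IsGaussian.memLp_two_id
  exact h.sub (memLp_const _)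

theorem integral_eval_sub_mul_eval_sub_multivariateGaussian (hS : S₁.PosSemidef) (i j : ι) :
    ∫ x, (x i - μ₂ i) * (x j - μ₂ j) ∂multivariateGaussian μ₁ S₁ =
      S₁ i j + (μ₁ i - μ₂ i) * (μ₁ j - μ₂ j) := by
  have hint (k : ι) : Integrable (fun x : EuclideanSpace ℝ ι ↦ x k)
      (multivariateGaussian μ₁ S₁) :=
    (EuclideanSpace.proj (𝕜 := ℝ) k).integrable_comp IsGaussian.integrable_id
  have hmean (k : ι) : ∫ x, (x k - μ₂ k) ∂multivariateGaussian μ₁ S₁ = μ₁ k - μ₂ k := by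
    rw [integral_sub (hint k) (integrable_const _)]
    have := (EuclideanSpace.proj (𝕜 := ℝ) k).integral_comp_comm
      (IsGaussian.integrable_id (μ := multivariateGaussian μ₁ S₁))
    simp only [id_eq, integral_id_multivariateGaussian] at this
    rw [integral_const, probReal_univ, one_smul]
    exact congrArg (· - μ₂ k) this
  have h := covariance_eq_sub (memLp_eval_sub_multivariateGaussian μ₁ μ₂ S₁ i)
    (memLp_eval_sub_multivariateGaussian μ₁ μ₂ S₁ j)
  rw [covariance_sub_const_left (hint i), covariance_sub_const_right (hint j),
    covariance_eval_multivariateGaussian hS, hmean, hmean] at h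
  simp only [Pi.mul_apply] at h
  linarith

omit [DecidableEq ι] in
theorem dotProduct_mulVec_eq_sum (M : Matrix ι ι ℝ) (v : ι → ℝ) :
    v ⬝ᵥ M *ᵥ v = ∑ i, ∑ j, M i j * (v i * v j) := by
  simp only [dotProduct, mulVec, Finset.mul_sum]
  exact Finset.sum_congr rfl fun i _ ↦ Finset.sum_congr rfl fun j _ ↦ by ring

theorem integrable_quadraticForm_multivariateGaussian (M S : Matrix ι ι ℝ) :
    Integrable (fun x ↦ (x - μ₂).ofLp ⬝ᵥ M *ᵥ (x - μ₂).ofLp) (multivariateGaussian μ₁ S) := by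
  simp_rw [dotProduct_mulVec_eq_sum]
  exact integrable_finsetSum _ fun i _ ↦ integrable_finsetSum _ fun j _ ↦
    ((memLp_eval_sub_multivariateGaussian μ₁ μ₂ S i).integrable_mul
      (memLp_eval_sub_multivariateGaussian μ₁ μ₂ S j)).const_mul _

theorem integral_quadraticForm_multivariateGaussian (M : Matrix ι ι ℝ) (hS : S₁.PosSemidef) :
    ∫ x, (x - μ₂).ofLp ⬝ᵥ M *ᵥ (x - μ₂).ofLp ∂multivariateGaussian μ₁ S₁ =
      (M * S₁).trace + (μ₁ - μ₂).ofLp ⬝ᵥ M *ᵥ (μ₁ - μ₂).ofLp := by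
  have hint (i j : ι) : Integrable (fun x : EuclideanSpace ℝ ι ↦
      M i j * ((x - μ₂).ofLp i * (x - μ₂).ofLp j)) (multivariateGaussian μ₁ S₁) :=
    ((memLp_eval_sub_multivariateGaussian μ₁ μ₂ S₁ i).integrable_mul
      (memLp_eval_sub_multivariateGaussian μ₁ μ₂ S₁ j)).const_mul _
  have hval (i j : ι) : ∫ x, M i j * ((x - μ₂).ofLp i * (x - μ₂).ofLp j)
      ∂multivariateGaussian μ₁ S₁ =
        M i j * S₁ j i + M i j * ((μ₁ - μ₂).ofLp i * (μ₁ - μ₂).ofLp j) := by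
    rw [integral_const_mul, ← mul_add]
    congr 1
    have hsymm : S₁ j i = S₁ i j := hS.isHermitian.apply i j
    rw [hsymm]
    exact integral_eval_sub_mul_eval_sub_multivariateGaussian μ₁ μ₂ hS i j
  simp_rw [dotProduct_mulVec_eq_sum]
  rw [integral_finsetSum _ fun i _ ↦ integrable_finsetSum _ fun j _ ↦ hint i j]
  simp_rw [integral_finsetSum _ fun j _ ↦ hint _ j, hval, Finset.sum_add_distrib]
  rfl

theorem klDiv_multivariateGaussian (hS₁ : S₁.PosDef) (hS₂ : S₂.PosDef) :
    klDiv (multivariateGaussian μ₁ S₁) (multivariateGaussian μ₂ S₂) ≠ ∞ ∧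
    (klDiv (multivariateGaussian μ₁ S₁) (multivariateGaussian μ₂ S₂)).toReal =
      ((S₂⁻¹ * S₁).trace - Fintype.card ι + Real.log S₂.det - Real.log S₁.det
        + (μ₁ - μ₂).ofLp ⬝ᵥ S₂⁻¹ *ᵥ (μ₁ - μ₂).ofLp) / 2 := by
  have hmeas (c : ℝ) (ν : EuclideanSpace ℝ ι) (S : Matrix ι ι ℝ) : Measurable
      fun x : EuclideanSpace ℝ ι ↦ c - (x - ν).ofLp ⬝ᵥ S⁻¹ *ᵥ (x - ν).ofLp / 2 := by
    unfold Matrix.mulVec dotProduct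
    fun_prop
  have hint₁ := integrable_quadraticForm_multivariateGaussian μ₁ μ₁ S₁⁻¹ S₁
  have hint₂ := integrable_quadraticForm_multivariateGaussian μ₁ μ₂ S₂⁻¹ S₁
  have hsub : Integrable (fun x ↦ (Real.log S₂.det - Real.log S₁.det) / 2 -
      (x - μ₁).ofLp ⬝ᵥ S₁⁻¹ *ᵥ (x - μ₁).ofLp / 2) (multivariateGaussian μ₁ S₁) :=
    (integrable_const _).sub (hint₁.div_const 2)
  have heq (c : ℝ) (x : EuclideanSpace ℝ ι) : (c - Real.log S₁.det / 2
        - (x - μ₁).ofLp ⬝ᵥ S₁⁻¹ *ᵥ (x - μ₁).ofLp / 2) - (c - Real.log S₂.det / 2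
        - (x - μ₂).ofLp ⬝ᵥ S₂⁻¹ *ᵥ (x - μ₂).ofLp / 2) =
      (Real.log S₂.det - Real.log S₁.det) / 2 - (x - μ₁).ofLp ⬝ᵥ S₁⁻¹ *ᵥ (x - μ₁).ofLp / 2
        + (x - μ₂).ofLp ⬝ᵥ S₂⁻¹ *ᵥ (x - μ₂).ofLp / 2 := by ring
  obtain ⟨hne, hkl⟩ := klDiv_withDensity_exp (hmeas _ _ _) (hmeas _ _ _)
    (multivariateGaussian_eq_withDensity μ₁ hS₁) (multivariateGaussian_eq_withDensity μ₂ hS₂)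
    ((hsub.add (hint₂.div_const 2)).congr (ae_of_all _ fun x ↦ (heq _ x).symm))
  refine ⟨hne, hkl.trans ?_⟩
  simp_rw [heq]
  rw [integral_add hsub (hint₂.div_const 2),
    integral_sub (integrable_const _) (hint₁.div_const 2), integral_const, integral_div, integral_div,
    integral_quadraticForm_multivariateGaussian _ _ _ hS₁.posSemidef,
    integral_quadraticForm_multivariateGaussian _ _ _ hS₁.posSemidef,
    nonsing_inv_mul _ (isUnit_iff_ne_zero.2 hS₁.det_pos.ne')]
  simp
  ring

end

/-! ### Scalar inequalities. -/

theorem Real.log_le_half_sub_inv {x : ℝ} (hx : 1 ≤ x) : Real.log x ≤ (x - x⁻¹) / 2 := by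
  have h := Real.self_le_sinh_iff.2 (Real.log_nonneg hx)
  rwa [Real.sinh_eq, Real.exp_neg, Real.exp_log (by linarith)] at h

/-- The factor 2 is the Taylor constant at 1, so the final coefficient of √(ε₁ε₂) loses nothing. For
x ≤ 1 the bound log(1+y) ≥ 2y/(y+2) is used at y = 1/x − 1. -/
theorem Real.sq_sub_one_le_mul_max {x : ℝ} (hx : 0 < x) :
    (x - 1) ^ 2 ≤ 2 * (x - 1 - Real.log x) * max 1 x := by
  rcases le_total x 1 with h | h
  · rw [max_eq_left h]
    have hinv : 0 ≤ x⁻¹ - 1 := sub_nonneg.2 ((one_le_inv₀ hx).2 h)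
    have hlog := Real.le_log_one_add_of_nonneg hinv
    rw [add_sub_cancel, Real.log_inv] at hlog
    have heq : 2 * (x⁻¹ - 1) / (x⁻¹ - 1 + 2) = 2 * (1 - x) / (1 + x) := by
      field_simp
      ring
    rw [heq] at hlog
    have h2 : (1 - x) ^ 2 / 2 + (1 - x) ≤ 2 * (1 - x) / (1 + x) := by
      rw [le_div_iff₀ (by linarith)]
      nlinarith [pow_nonneg (sub_nonneg.2 h) 3]
    linarith
  · rw [max_eq_right h]
    have hlog := Real.log_le_half_sub_inv h
    have hxx : x⁻¹ * x = 1 := inv_mul_cancel₀ hx.ne'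
    nlinarith [mul_le_mul_of_nonneg_right hlog hx.le]

theorem Real.le_one_add_two_mul_of_sub_one_sub_log_le {x s : ℝ} (hx : 0 < x) (hs : 0 ≤ s)
    (hs' : s ≤ 1 / 2) (h : x - 1 - Real.log x ≤ s ^ 2) : x ≤ 1 + 2 * s := by
  by_contra! hlt
  have h1 := Real.sq_sub_one_le_mul_max hx
  rw [max_eq_right (by linarith)] at h1
  -- With y = x − 1 > 2s, `h1` and `h` give y² ≤ 2s²(1+y), which fails beyond y = 2s because 2s ≤ 1.
  nlinarith [mul_le_mul_of_nonneg_right h hx.le, mul_nonneg hs hs, mul_nonneg hs (sub_nonneg.2 hs')]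

/-- `P`, `Q` are the covariance parts and `p`, `q` the mean parts of s², u²; `FA`, `FB` are squared
Frobenius norms, `T` the trace term, `H` = aᵀBa and `G` = aᵀBc. -/
theorem cross_term_le_of_sq_bounds {P Q p q T FA FB G H s u : ℝ} (hs : 0 ≤ s) (hu : 0 ≤ u)
    (hP : 0 ≤ P) (hQ : 0 ≤ Q) (hp : 0 ≤ p) (hq : 0 ≤ q) (hPs : P + p = s ^ 2) (hQu : Q + q = u ^ 2)
    (hFA0 : 0 ≤ FA) (hFA : FA ≤ 2 * P * (1 + 2 * s)) (hFB : FB ≤ 2 * Q * (1 + 2 * u))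
    (hT : T ^ 2 ≤ FB * FA) (hH : H ≤ (1 + 2 * u) * p) (hG : G ^ 2 ≤ H * q) :
    T + (H - p) - 2 * G ≤ 2 * (s * u) * (1 + s + u) + 2 * u * s ^ 2 := by
  have hk : (1 + 2 * s) * (1 + 2 * u) ≤ (1 + s + u) ^ 2 := by nlinarith [sq_nonneg (s - u)]
  have hPQ : √(P * Q) ^ 2 = P * Q := Real.sq_sqrt (by positivity)
  have hpq : √(p * q) ^ 2 = p * q := Real.sq_sqrt (by positivity)
  have hT' : T ≤ 2 * (√(P * Q) * (1 + s + u)) := by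
    refine (abs_le_of_sq_le_sq' ?_ (by positivity)).2
    calc T ^ 2 ≤ FB * FA := hT
      _ ≤ (2 * Q * (1 + 2 * u)) * (2 * P * (1 + 2 * s)) := by gcongr
      _ = 4 * (P * Q) * ((1 + 2 * s) * (1 + 2 * u)) := by ring
      _ ≤ 4 * (P * Q) * (1 + s + u) ^ 2 := by gcongr
      _ = (2 * (√(P * Q) * (1 + s + u))) ^ 2 := by rw [mul_pow, mul_pow, hPQ]; ring
  -- The spare factor 1 + 2s is inserted so that `T` and `G` share the constant 1 + s + u.
  have hG' : -G ≤ √(p * q) * (1 + s + u) := by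
    refine (abs_le_of_sq_le_sq' ?_ (by positivity)).2
    calc (-G) ^ 2 ≤ H * q := by rwa [neg_sq]
      _ ≤ ((1 + 2 * u) * p) * q := by gcongr
      _ ≤ ((1 + 2 * s) * (1 + 2 * u)) * (p * q) := by
        have : 0 ≤ 2 * s * (1 + 2 * u) * (p * q) := by positivity
        linarith
      _ ≤ (1 + s + u) ^ 2 * (p * q) := by gcongr
      _ = (√(p * q) * (1 + s + u)) ^ 2 := by rw [mul_pow, hpq]; ring
  -- Cauchy–Schwarz for (√P, √p) and (√Q, √q).
  have hsum : √(P * Q) + √(p * q) ≤ s * u := by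
    refine (abs_le_of_sq_le_sq' ?_ (by positivity)).2
    rw [mul_pow, ← hPs, ← hQu, add_sq, hPQ, hpq]
    have : 2 * (√(P * Q) * √(p * q)) ≤ P * q + p * Q := by
      rw [← Real.sqrt_mul (by positivity), show P * Q * (p * q) = (P * q) * (p * Q) by ring,
        Real.sqrt_mul (by positivity)]
      nlinarith [sq_nonneg (√(P * q) - √(p * Q)), Real.sq_sqrt (mul_nonneg hP hq),
        Real.sq_sqrt (mul_nonneg hp hQ)]
    linarith
  have hup : 2 * u * p ≤ 2 * u * s ^ 2 := by gcongr; linarith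
  have := mul_le_mul_of_nonneg_right hsum (by positivity : 0 ≤ 1 + s + u)
  linarith

/-! ### Spectral and Cauchy–Schwarz bounds for matrices. -/

section
open Matrix MatrixOrder
variable {ι : Type*} [Fintype ι] [DecidableEq ι]

theorem Matrix.IsHermitian.trace_mul_self {A : Matrix ι ι ℝ} (hA : A.IsHermitian) :
    (A * A).trace = ∑ i, hA.eigenvalues i ^ 2 := by
  conv_lhs => rw [hA.spectral_theorem, ← map_mul, Unitary.conjStarAlgAut_apply, trace_mul_comm,
    ← Matrix.mul_assoc]
  simp [diagonal_mul_diagonal, trace_diagonal, sq]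

theorem Matrix.IsHermitian.dotProduct_mulVec_le {A : Matrix ι ι ℝ} (hA : A.IsHermitian) {c : ℝ}
    (hc : ∀ i, hA.eigenvalues i ≤ c) (v : ι → ℝ) : v ⬝ᵥ A *ᵥ v ≤ c * (v ⬝ᵥ v) := by
  have h : A ≤ algebraMap ℝ _ c := by
    refine le_algebraMap_of_spectrum_le (ha := hA) ?_
    rw [hA.spectrum_real_eq_range_eigenvalues]
    rintro _ ⟨i, rfl⟩
    exact hc i
  have := (Matrix.le_iff.1 h).dotProduct_mulVec_nonneg v
  rw [Algebra.algebraMap_eq_smul_one, sub_mulVec, smul_mulVec, one_mulVec, dotProduct_sub,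
    dotProduct_smul, star_trivial, smul_eq_mul] at this
  linarith

omit [DecidableEq ι] in
theorem Matrix.IsHermitian.trace_mul_sq_le {X Y : Matrix ι ι ℝ} (hX : X.IsHermitian)
    (hY : Y.IsHermitian) : (X * Y).trace ^ 2 ≤ (X * X).trace * (Y * Y).trace := by
  have h (Z W : Matrix ι ι ℝ) (hW : W.IsHermitian) :
      (Z * W).trace = ∑ p : ι × ι, Z p.1 p.2 * W p.1 p.2 := by
    rw [Fintype.sum_prod_type]
    simp_rw [trace, diag_apply, mul_apply]
    exact Finset.sum_congr rfl fun i _ ↦ Finset.sum_congr rfl fun j _ ↦ by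
      rw [← hW.apply i j, star_trivial]
  rw [h X Y hY, h X X hX, h Y Y hY]
  simpa only [sq] using Finset.sum_mul_sq_le_sq_mul_sq Finset.univ
    (fun p : ι × ι ↦ X p.1 p.2) fun p ↦ Y p.1 p.2

theorem Matrix.PosSemidef.dotProduct_mulVec_sq_le {B : Matrix ι ι ℝ} (hB : B.PosSemidef)
    (v w : ι → ℝ) : (v ⬝ᵥ B *ᵥ w) ^ 2 ≤ (v ⬝ᵥ B *ᵥ v) * (w ⬝ᵥ B *ᵥ w) := by
  have hRT : (CFC.sqrt B)ᵀ = CFC.sqrt B := (CFC.sqrt_nonneg B).isSelfAdjoint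
  have h (x y : ι → ℝ) : x ⬝ᵥ B *ᵥ y = ∑ i, (CFC.sqrt B *ᵥ x) i * (CFC.sqrt B *ᵥ y) i := by
    conv_lhs => rw [← CFC.sqrt_mul_sqrt_self B hB.nonneg, ← mulVec_mulVec, dotProduct_mulVec,
      ← mulVec_transpose, hRT]
    rfl
  rw [h, h, h]
  simpa only [sq] using Finset.sum_mul_sq_le_sq_mul_sq Finset.univ
    (fun i ↦ (CFC.sqrt B *ᵥ v) i) fun i ↦ (CFC.sqrt B *ᵥ w) i

theorem Matrix.PosDef.trace_sub_card_sub_log_det {A : Matrix ι ι ℝ} (hA : A.PosDef) :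
    A.trace - Fintype.card ι - Real.log A.det =
      ∑ i, (hA.isHermitian.eigenvalues i - 1 - Real.log (hA.isHermitian.eigenvalues i)) := by
  rw [hA.isHermitian.trace_eq_sum_eigenvalues, hA.isHermitian.det_eq_prod_eigenvalues]
  simp only [RCLike.ofReal_real_eq_id, id_eq]
  rw [Real.log_prod fun i _ ↦ (hA.eigenvalues_pos i).ne']
  simp [Finset.sum_sub_distrib]

theorem Matrix.PosDef.trace_sub_card_sub_log_det_nonneg {A : Matrix ι ι ℝ} (hA : A.PosDef) :
    0 ≤ A.trace - Fintype.card ι - Real.log A.det := by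
  rw [hA.trace_sub_card_sub_log_det]
  exact Finset.sum_nonneg fun i _ ↦
    sub_nonneg.2 (Real.log_le_sub_one_of_pos (hA.eigenvalues_pos i))

/-- The summands λ − 1 − log λ are nonnegative, so each is at most the whole sum. -/
theorem Matrix.PosDef.eigenvalues_le_of_trace_sub_card_sub_log_det_le {A : Matrix ι ι ℝ}
    (hA : A.PosDef) {s : ℝ} (hs : 0 ≤ s) (hs' : s ≤ 1 / 2)
    (h : A.trace - Fintype.card ι - Real.log A.det ≤ s ^ 2) (i : ι) :
    hA.isHermitian.eigenvalues i ≤ 1 + 2 * s := by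
  rw [hA.trace_sub_card_sub_log_det] at h
  refine Real.le_one_add_two_mul_of_sub_one_sub_log_le (hA.eigenvalues_pos i) hs hs' (le_trans ?_ h)
  exact Finset.single_le_sum (f := fun i ↦ hA.isHermitian.eigenvalues i - 1 -
    Real.log (hA.isHermitian.eigenvalues i)) (fun j _ ↦
    sub_nonneg.2 (Real.log_le_sub_one_of_pos (hA.eigenvalues_pos j))) (Finset.mem_univ i)

theorem Matrix.PosDef.trace_sub_one_mul_self_le {A : Matrix ι ι ℝ} (hA : A.PosDef) {s : ℝ}
    (hs : 0 ≤ s) (hs' : s ≤ 1 / 2) (h : A.trace - Fintype.card ι - Real.log A.det ≤ s ^ 2) :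
    ((A - 1) * (A - 1)).trace ≤
      2 * (A.trace - Fintype.card ι - Real.log A.det) * (1 + 2 * s) := by
  have heig := hA.eigenvalues_le_of_trace_sub_card_sub_log_det_le hs hs' h
  have hsq : ((A - 1) * (A - 1)).trace = ∑ i, (hA.isHermitian.eigenvalues i - 1) ^ 2 := by
    have h1 : (A - 1) * (A - 1) = A * A - 2 • A + 1 := by noncomm_ring
    rw [h1, trace_add, trace_sub, trace_smul, hA.isHermitian.trace_mul_self,
      hA.isHermitian.trace_eq_sum_eigenvalues, trace_one]
    simp only [RCLike.ofReal_real_eq_id, id_eq, sub_sq, Finset.sum_add_distrib,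
      Finset.sum_sub_distrib, ← Finset.mul_sum, mul_one]
    simp
  rw [hsq, hA.trace_sub_card_sub_log_det, Finset.mul_sum, Finset.sum_mul]
  refine Finset.sum_le_sum fun i _ ↦ (Real.sq_sub_one_le_mul_max (hA.eigenvalues_pos i)).trans ?_
  refine mul_le_mul_of_nonneg_left (max_le (by linarith) (heig i)) ?_
  linarith [Real.log_le_sub_one_of_pos (hA.eigenvalues_pos i)]

theorem Matrix.PosDef.cross_term_le {A B : Matrix ι ι ℝ} (hA : A.PosDef) (hB : B.PosDef)
    (a c : ι → ℝ) {s u : ℝ} (hs : 0 ≤ s) (hs' : s ≤ 1 / 2) (hu : 0 ≤ u) (hu' : u ≤ 1 / 2)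
    (hAs : A.trace - Fintype.card ι - Real.log A.det + a ⬝ᵥ a = s ^ 2)
    (hBu : B.trace - Fintype.card ι - Real.log B.det + c ⬝ᵥ B *ᵥ c = u ^ 2) :
    ((B - 1) * (A - 1)).trace + (a ⬝ᵥ B *ᵥ a - a ⬝ᵥ a) - 2 * (a ⬝ᵥ B *ᵥ c) ≤
      2 * (s * u) * (1 + s + u) + 2 * u * s ^ 2 := by
  have hp : 0 ≤ a ⬝ᵥ a := by simpa using dotProduct_star_self_nonneg a
  have hq : 0 ≤ c ⬝ᵥ B *ᵥ c := hB.posSemidef.dotProduct_mulVec_nonneg c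
  have hP := hA.trace_sub_card_sub_log_det_nonneg
  have hQ := hB.trace_sub_card_sub_log_det_nonneg
  have hFA := hA.trace_sub_one_mul_self_le hs hs' (by linarith)
  have hFB := hB.trace_sub_one_mul_self_le hu hu' (by linarith)
  have hT := (hB.isHermitian.sub isHermitian_one).trace_mul_sq_le
    (hA.isHermitian.sub isHermitian_one)
  have hH := hB.isHermitian.dotProduct_mulVec_le
    (hB.eigenvalues_le_of_trace_sub_card_sub_log_det_le hu hu' (by linarith)) a
  have hG := hB.posSemidef.dotProduct_mulVec_sq_le a c
  have hFA0 : 0 ≤ ((A - 1) * (A - 1)).trace := by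
    have h := (posSemidef_conjTranspose_mul_self (A - 1)).trace_nonneg
    rwa [(hA.isHermitian.sub isHermitian_one).eq] at h
  exact cross_term_le_of_sq_bounds hs hu hP hQ hp hq hAs hBu hFA0 hFA hFB hT hH hG

end

/-! ### Whitening and the bound for three Gaussians. -/

section
open Matrix MatrixOrder
variable {ι : Type*} [Fintype ι] [DecidableEq ι]

omit [DecidableEq ι] in
theorem dotProduct_mulVec_mulVec_conj (R M : Matrix ι ι ℝ) (v : ι → ℝ) :
    (R *ᵥ v) ⬝ᵥ M *ᵥ (R *ᵥ v) = v ⬝ᵥ (Rᵀ * M * R) *ᵥ v := by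
  rw [mulVec_mulVec, dotProduct_mulVec, vecMul_mulVec, ← dotProduct_mulVec, Matrix.mul_assoc]

theorem toReal_klDiv_multivariateGaussian_le (μ₁ μ₂ μ₃ : EuclideanSpace ℝ ι)
    {S₁ S₂ S₃ : Matrix ι ι ℝ} (h₁ : S₁.PosDef) (h₂ : S₂.PosDef) (h₃ : S₃.PosDef) {s u : ℝ}
    (hs : 0 ≤ s) (hs' : s ≤ 1 / 2) (hu : 0 ≤ u) (hu' : u ≤ 1 / 2)
    (h₁₂ : (klDiv (multivariateGaussian μ₁ S₁) (multivariateGaussian μ₂ S₂)).toReal = s ^ 2 / 2)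
    (h₂₃ : (klDiv (multivariateGaussian μ₂ S₂) (multivariateGaussian μ₃ S₃)).toReal = u ^ 2 / 2) :
    (klDiv (multivariateGaussian μ₁ S₁) (multivariateGaussian μ₃ S₃)).toReal ≤
      s ^ 2 / 2 + u ^ 2 / 2 + s * u + s * u * (2 * s + u) := by
  obtain ⟨R, hRR, hRT⟩ : ∃ R : Matrix ι ι ℝ, R * R = S₂ ∧ Rᵀ = R :=
    ⟨CFC.sqrt S₂, CFC.sqrt_mul_sqrt_self _ h₂.posSemidef.nonneg,
      (CFC.sqrt_nonneg S₂).isSelfAdjoint⟩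
  have hdet : R.det * R.det = S₂.det := by rw [← det_mul, hRR]
  have hdet0 : R.det ≠ 0 := fun h ↦ h₂.det_pos.ne' (by rw [← hdet, h, zero_mul])
  have hunit : IsUnit R.det := isUnit_iff_ne_zero.2 hdet0
  have hR : IsUnit R := (isUnit_iff_isUnit_det R).2 hunit
  have hRi : IsUnit R⁻¹ := (isUnit_nonsing_inv_iff).2 hR
  have hRiT : R⁻¹ᵀ = R⁻¹ := by rw [transpose_nonsing_inv, hRT]
  have hS₂i : S₂⁻¹ = R⁻¹ * R⁻¹ := by rw [← hRR, Matrix.mul_inv_rev]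
  have hA : (R⁻¹ * S₁ * R⁻¹).PosDef := by
    have h := (Matrix.IsUnit.posDef_star_right_conjugate_iff hRi).2 h₁
    rwa [star_eq_conjTranspose, conjTranspose_eq_transpose_of_trivial, hRiT] at h
  have hB : (R * S₃⁻¹ * R).PosDef := by
    have h := (Matrix.IsUnit.posDef_star_right_conjugate_iff hR).2 h₃.inv
    rwa [star_eq_conjTranspose, conjTranspose_eq_transpose_of_trivial, hRT] at h
  have hlogA : Real.log (R⁻¹ * S₁ * R⁻¹).det = Real.log S₁.det - Real.log S₂.det := by
    rw [det_mul, mul_comm, ← det_mul, ← Matrix.mul_assoc, ← hS₂i, det_mul, det_nonsing_inv, Ring.inverse_eq_inv',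
      Real.log_mul (inv_ne_zero h₂.det_pos.ne') h₁.det_pos.ne', Real.log_inv]
    ring
  have hlogB : Real.log (R * S₃⁻¹ * R).det = Real.log S₂.det - Real.log S₃.det := by
    rw [det_mul, mul_comm, ← det_mul, ← Matrix.mul_assoc, hRR, det_mul, det_nonsing_inv,
      Ring.inverse_eq_inv', Real.log_mul h₂.det_pos.ne' (inv_ne_zero h₃.det_pos.ne'), Real.log_inv]
    ring
  have htrA : (R⁻¹ * S₁ * R⁻¹).trace = (S₂⁻¹ * S₁).trace := by
    rw [trace_mul_comm, ← Matrix.mul_assoc, hS₂i]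
  have htrB : (R * S₃⁻¹ * R).trace = (S₃⁻¹ * S₂).trace := by
    rw [trace_mul_comm, ← Matrix.mul_assoc, hRR, trace_mul_comm]
  have htrBA : ((R * S₃⁻¹ * R) * (R⁻¹ * S₁ * R⁻¹)).trace = (S₃⁻¹ * S₁).trace := by
    rw [show (R * S₃⁻¹ * R) * (R⁻¹ * S₁ * R⁻¹) = R * S₃⁻¹ * (R * R⁻¹) * S₁ * R⁻¹ by
      simp only [Matrix.mul_assoc], mul_nonsing_inv _ hunit, Matrix.mul_one, trace_mul_comm,
      ← Matrix.mul_assoc, ← Matrix.mul_assoc, nonsing_inv_mul _ hunit, Matrix.one_mul]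
  set A := R⁻¹ * S₁ * R⁻¹
  set B := R * S₃⁻¹ * R
  set a := R⁻¹ *ᵥ (μ₁ - μ₂).ofLp with ha
  set c := R⁻¹ *ᵥ (μ₃ - μ₂).ofLp with hc
  have hRa : R *ᵥ a = (μ₁ - μ₂).ofLp := by
    rw [ha, mulVec_mulVec, mul_nonsing_inv _ hunit, one_mulVec]
  have hRc : R *ᵥ c = (μ₃ - μ₂).ofLp := by
    rw [hc, mulVec_mulVec, mul_nonsing_inv _ hunit, one_mulVec]
  have hquadB (v : ι → ℝ) : (R *ᵥ v) ⬝ᵥ S₃⁻¹ *ᵥ (R *ᵥ v) = v ⬝ᵥ B *ᵥ v := by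
    rw [dotProduct_mulVec_mulVec_conj, hRT]
  have hq₁₂ : (μ₁ - μ₂).ofLp ⬝ᵥ S₂⁻¹ *ᵥ (μ₁ - μ₂).ofLp = a ⬝ᵥ a := by
    rw [ha, dotProduct_mulVec (R⁻¹ *ᵥ _), vecMul_mulVec, hRiT, ← hS₂i, ← dotProduct_mulVec]
  have hq₂₃ : (μ₂ - μ₃).ofLp ⬝ᵥ S₃⁻¹ *ᵥ (μ₂ - μ₃).ofLp = c ⬝ᵥ B *ᵥ c := by
    rw [← hquadB, hRc, ← neg_sub μ₃ μ₂, WithLp.ofLp_neg, mulVec_neg, neg_dotProduct_neg]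
  have hq₁₃ : (μ₁ - μ₃).ofLp ⬝ᵥ S₃⁻¹ *ᵥ (μ₁ - μ₃).ofLp =
      a ⬝ᵥ B *ᵥ a - 2 * (a ⬝ᵥ B *ᵥ c) + c ⬝ᵥ B *ᵥ c := by
    have hsub : (μ₁ - μ₃).ofLp = R *ᵥ (a - c) := by
      rw [mulVec_sub, hRa, hRc, WithLp.ofLp_sub, WithLp.ofLp_sub, WithLp.ofLp_sub, sub_sub_sub_cancel_right]
    have hsymm : c ⬝ᵥ B *ᵥ a = a ⬝ᵥ B *ᵥ c := by
      have hBT : Bᵀ = B := hB.isHermitian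
      rw [dotProduct_mulVec, ← mulVec_transpose, hBT, dotProduct_comm]
    rw [hsub, hquadB, mulVec_sub, dotProduct_sub, sub_dotProduct, sub_dotProduct, hsymm]
    ring
  have hk₁₂ := (klDiv_multivariateGaussian μ₁ μ₂ h₁ h₂).2
  have hk₂₃ := (klDiv_multivariateGaussian μ₂ μ₃ h₂ h₃).2
  have hk₁₃ := (klDiv_multivariateGaussian μ₁ μ₃ h₁ h₃).2
  rw [h₁₂, hq₁₂, ← htrA] at hk₁₂
  rw [h₂₃, hq₂₃, ← htrB] at hk₂₃
  rw [hq₁₃, ← htrBA] at hk₁₃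
  have key := hA.cross_term_le hB a c hs hs' hu hu' (by linarith) (by linarith)
  -- This makes the left side of `key` equal to twice the third divergence minus s² + u².
  have htr : ((B - 1) * (A - 1)).trace = (B * A).trace - B.trace - A.trace + Fintype.card ι := by
    rw [show (B - 1) * (A - 1) = B * A - B - A + 1 by noncomm_ring, trace_add, trace_sub,
      trace_sub, trace_one]
  linarith

end

/-! ### Error terms and conclusion. -/

theorem isLittleO_sqrt_two_mul_pow_three :
    (fun ε : ℝ ↦ 3 * √(2 * ε) ^ 3) =o[𝓝[>] (0 : ℝ)] (fun ε : ℝ ↦ ε) := by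
  have h0 : Filter.Tendsto (fun ε : ℝ ↦ 6 * √(2 * ε)) (𝓝[>] 0) (𝓝 0) := by
    have hc : Continuous fun ε : ℝ ↦ 6 * √(2 * ε) := by fun_prop
    simpa using (hc.tendsto 0).mono_left nhdsWithin_le_nhds
  have h1 := ((isLittleO_one_iff ℝ).2 h0).mul_isBigO (isBigO_refl (fun ε : ℝ ↦ ε) (𝓝[>] 0))
  refine h1.congr' ?_ (by simp)
  filter_upwards [self_mem_nhdsWithin] with ε hε
  have hsq : √(2 * ε) ^ 2 = 2 * ε := Real.sq_sqrt (by linarith [Set.mem_Ioi.1 hε])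
  rw [pow_succ, hsq]
  ring

theorem theorem2 :
    ∃ (r₁ r₂ : ℝ → ℝ) (δ : ℝ),
      0 < δ ∧
      r₁ =o[𝓝[>] (0 : ℝ)] (fun ε : ℝ => ε) ∧
      r₂ =o[𝓝[>] (0 : ℝ)] (fun ε : ℝ => ε) ∧
      ∀ (ε₁ ε₂ : ℝ), 0 < ε₁ → ε₁ < δ → 0 < ε₂ → ε₂ < δ →
      ∀ (n : ℕ) (μ₁ μ₂ μ₃ : EuclideanSpace ℝ (Fin n)) (S₁ S₂ S₃ : Matrix (Fin n) (Fin n) ℝ),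
        S₁.PosDef → S₂.PosDef → S₃.PosDef →
        klDiv (multivariateGaussian μ₁ S₁) (multivariateGaussian μ₂ S₂) = ENNReal.ofReal ε₁ →
        klDiv (multivariateGaussian μ₂ S₂) (multivariateGaussian μ₃ S₃) = ENNReal.ofReal ε₂ →
        klDiv (multivariateGaussian μ₁ S₁) (multivariateGaussian μ₃ S₃) ≠ ∞ ∧
        (klDiv (multivariateGaussian μ₁ S₁) (multivariateGaussian μ₃ S₃)).toReal
          ≤ ε₁ + ε₂ + 2 * Real.sqrt (ε₁ * ε₂) + r₁ ε₁ + r₂ ε₂ := by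
  -- With s = √(2ε₁) and u = √(2ε₂), δ = 1/8 ensures s, u ≤ 1/2, and the remainders absorb su(2s+u),
  -- which `hcubic` separates into s³ and u³.
  refine ⟨fun ε ↦ 3 * √(2 * ε) ^ 3, fun ε ↦ 3 * √(2 * ε) ^ 3, 1 / 8, by norm_num,
    isLittleO_sqrt_two_mul_pow_three, isLittleO_sqrt_two_mul_pow_three, ?_⟩
  intro ε₁ ε₂ hε₁ hδ₁ hε₂ hδ₂ n μ₁ μ₂ μ₃ S₁ S₂ S₃ h₁ h₂ h₃ h₁₂ h₂₃
  refine ⟨(klDiv_multivariateGaussian μ₁ μ₃ h₁ h₃).1, ?_⟩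
  have hs2 : √(2 * ε₁) ^ 2 = 2 * ε₁ := Real.sq_sqrt (by positivity)
  have hu2 : √(2 * ε₂) ^ 2 = 2 * ε₂ := Real.sq_sqrt (by positivity)
  have hsu : √(2 * ε₁) * √(2 * ε₂) = 2 * √(ε₁ * ε₂) := by
    rw [← Real.sqrt_mul (by positivity), show 2 * ε₁ * (2 * ε₂) = 2 ^ 2 * (ε₁ * ε₂) by ring,
      Real.sqrt_mul (by positivity), Real.sqrt_sq (by norm_num)]
  have hs0 := Real.sqrt_nonneg (2 * ε₁)
  have hu0 := Real.sqrt_nonneg (2 * ε₂)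
  have hle := toReal_klDiv_multivariateGaussian_le μ₁ μ₂ μ₃ h₁ h₂ h₃
    hs0 (Real.sqrt_le_iff.2 ⟨by norm_num, by linarith⟩)
    hu0 (Real.sqrt_le_iff.2 ⟨by norm_num, by linarith⟩)
    (by rw [h₁₂, ENNReal.toReal_ofReal hε₁.le, hs2]; ring)
    (by rw [h₂₃, ENNReal.toReal_ofReal hε₂.le, hu2]; ring)
  have hcubic {s u : ℝ} (hs : 0 ≤ s) (hu : 0 ≤ u) :
      s * u * (2 * s + u) ≤ 3 * s ^ 3 + 3 * u ^ 3 := by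
    have : 0 ≤ (s + u) * (s - u) ^ 2 := by positivity
    nlinarith [pow_nonneg hs 3, pow_nonneg hu 3, mul_nonneg (mul_nonneg hs hu) hu]
  have := hcubic hs0 hu0
  rw [hs2, hu2, hsu] at hle
  rw [hsu] at this
  linarith
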